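/- Let $X$ denote either the complex vector space $C(\mathbb{R},\mathbb{C})$ of continuous functions $f:\mathbb{R}\to\mathbb{C}$ or the space $\mathcal{D}'(\mathbb{R})$ of complex valued Schwartz distributions on $\mathbb{R}$. For $h\in\mathbb{R}$ let $\tau_h$ be the translation operator on $X$, given by $(\tau_hf)(t)=f(t+h)$ if $f$ is a function, and by $(\tau_hf)\{\phi\}=f\{\tau_{-h}\phi\}$ for every test function $\phi$ if $f$ is a distribution; let $\Delta_h=\tau_h-\mathrm{id}$, and let $\Delta_h^m$ be its $m$-th iterate. Let $m\ge 1$ be an integer, let $h_1,h_2$ be non-zero real numbers with $h_1/h_2\notin\mathbb{Q}$, and let $V$ be a finite dimensional complex subspace of $X$ such that $\Delta_{h_1}^m(V)\subseteq V$ and $\Delta_{h_2}^m(V)\subseteq V$. Then there exists a finite dimensional subspace $W$ of $X$ which contains $V$ and is translation invariant, i.e. $\tau_h(W)\subseteq W$ for all $h\in\mathbb{R}$. Consequently, every element of $V$ is an exponential polynomial, i.e. it is a function of the form $t\mapsto\sum_{i=1}^{s}p_i(t)e^{\lambda_it}$ with $\lambda_i\in\mathbb{C}$ and complex polynomials $p_i$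 (in the case of distributions: the distribution $\phi\mapsto\int_{\mathbb{R}}\phi(t)f(t)\,dt$ given by such a function $f$). -/

import Mathlib

open scoped Distributions

noncomputable section

namespace DeltaInvariant

/-- The complex valued (Schwartz) distributions on the whole real line. As always in Mathlib they
are tested against real valued test functions: a real-linear continuous map from real test functions
to `ℂ` is the same as a complex-linear continuous functional on complex test functions. -/
abbrev ComplexDistribution : Type := 𝓓'((⊤ : TopologicalSpace.Opens ℝ), ℂ)

/-- The space of (real valued) test functions on the real line. -/
abbrev TestFun : Type := 𝓓((⊤ : TopologicalSpace.Opens ℝ), ℝ)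

/-- Translation of continuous functions: `(τ_h f)(t) = f (t + h)`. -/
def translateFun (h : ℝ) : Module.End ℂ C(ℝ, ℂ) where
  toFun f := f.comp ⟨fun t => t + h, by fun_prop⟩
  map_add' _ _ := rfl
  map_smul' _ _ := rfl

/-- The translate `K - h` of a compact set. -/
def shiftCompacts (h : ℝ) (K : TopologicalSpace.Compacts ℝ) : TopologicalSpace.Compacts ℝ :=
  K.map (fun t => t - h) (by fun_prop)

/-- Translation of test functions supported in a fixed compact set. -/
def translateSupportedIn (h : ℝ) (K : TopologicalSpace.Compacts ℝ) :
    𝓓^{⊤}_{K}(ℝ, ℝ) →L[ℝ] 𝓓^{⊤}_{shiftCompacts h K}(ℝ, ℝ) :=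
  ContDiffMapSupportedIn.mkCLM ℝ (fun f t => f (t + h))
    (fun _ _ _ => rfl) (fun _ _ _ => rfl)
    (fun f => f.contDiff.comp (contDiff_id.add contDiff_const))
    (fun f t ht => f.zero_on_compl fun hK =>
      ht ⟨t + h, hK, by simp⟩)
    (fun i _ => ⟨{i}, 1, zero_le_one, fun f t _ => by
      rw [iteratedFDeriv_comp_add_right, one_mul, Finset.sup_singleton]
      exact ContDiffMapSupportedIn.norm_iteratedFDeriv_apply_le_seminorm_top ℝ⟩)

/-- Translation of test functions: `(τ_h φ)(t) = φ (t + h)`. -/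
def translateTest (h : ℝ) : TestFun →L[ℝ] TestFun :=
  TestFunction.limitCLM ℝ
    (fun φ => ⟨fun t => φ (t + h), φ.contDiff.comp (contDiff_id.add contDiff_const),
      φ.hasCompactSupport.comp_homeomorph (Homeomorph.addRight h), fun _ _ => trivial⟩)
    (fun K _ => TestFunction.ofSupportedInCLM ℝ (fun _ _ => trivial) ∘L translateSupportedIn h K)
    (fun _ _ _ => rfl)

theorem translateTest_apply (h : ℝ) (φ : TestFun) (t : ℝ) :
    translateTest h φ t = φ (t + h) := rfl

/-- Translation of distributions: `(τ_h T){φ} = T{τ_{-h} φ}`. -/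
def translateDistribution (h : ℝ) : Module.End ℂ ComplexDistribution where
  toFun T := (translateTest (-h)).precompCompactConvergenceCLM ℂ T
  map_add' _ _ := rfl
  map_smul' _ _ := rfl

theorem translateDistribution_apply (h : ℝ) (T : ComplexDistribution) (φ : TestFun) :
    translateDistribution h T φ = T (translateTest (-h) φ) := rfl

/-- The difference operator `Δ_h = τ_h - 1` of a family of translation operators `τ`. Its `m`-th
power in `Module.End ℂ X` is the iterate `Δ_h^m`. -/
def difference {X : Type*} [AddCommGroup X] [Module ℂ X] (τ : ℝ → Module.End ℂ X) (h : ℝ) :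
    Module.End ℂ X :=
  τ h - 1

/-- `τ_h(W) ⊆ W` for all real `h`. -/
def TranslationInvariant {X : Type*} [AddCommGroup X] [Module ℂ X] (τ : ℝ → Module.End ℂ X)
    (W : Submodule ℂ X) : Prop :=
  ∀ h : ℝ, W.map (τ h) ≤ W

/-- Exponential polynomials: finite sums `∑ p_μ(t) e^{μ t}` with `μ ∈ ℂ` and `p_μ ∈ ℂ[t]`. -/
def IsExpPoly (f : ℝ → ℂ) : Prop :=
  ∃ (s : Finset ℂ) (p : ℂ → Polynomial ℂ),
    ∀ t : ℝ, f t = ∑ μ ∈ s, (p μ).eval (t : ℂ) * Complex.exp (μ * t)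

/-- A distribution is an exponential polynomial if it is the distribution `φ ↦ ∫ φ f` of an
exponential polynomial `f`. -/
def IsExpPolyDistribution (T : ComplexDistribution) : Prop :=
  ∃ f : ℝ → ℂ, IsExpPoly f ∧ ∀ φ : TestFun, T φ = ∫ t : ℝ, (φ t : ℂ) * f t

end DeltaInvariant

end

noncomputable section

namespace DeltaInvariant

open Polynomial MeasureTheory

/-! ### Differences of commuting operators -/

section Algebra

variable {X : Type*} [AddCommGroup X] [Module ℂ X]

/-! The operators `A = Δ_{h₁}` and `B = Δ_{h₂}` commute, and `A ^ m`, `B ^ m` preserve `V`. Hence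
the sum `W` of the spaces `B ^ j (A ^ i V)` with `i, j < m` is finite dimensional, contains `V` and
is invariant under `A` and `B` (`exists_le_map_le`), so also under `τ_{h₁}` and `τ_{h₂}`. The
translations `h` with `τ_h W = W` form a subgroup of `ℝ`, which is dense because `h₁ / h₂` is
irrational. Since `h ↦ τ_h x` is continuous and finite dimensional spaces are closed, every
translation preserves `W` (`translateDual_mem_of_irrational`).

Limits of difference quotients then show that `W` is stable under differentiation (`derivDual_mem`).
So a nonzero polynomial in `d/dt` annihilates `W`. Splitting it into linear factors over `ℂ` reduces
the claim to weak equations `L' - l L = g` with `g` an exponential polynomial, whose solutions are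
exponential polynomials (`IsExpPolyDual.of_derivDual_sub`).

Both choices of `X` are treated at once inside the algebraic dual of the complex test functions,
with pointwise convergence as the only topology. Each needs just an injective equivariant linear map
into this dual whose values satisfy `IsRegular`. -/

/-- The sum of the images of `V` under the powers `A ^ i` with `i < m`. -/
def powSum (A : Module.End ℂ X) (m : ℕ) (V : Submodule ℂ X) : Submodule ℂ X :=
  ⨆ i : Fin m, V.map (A ^ (i : ℕ))

theorem le_powSum (A : Module.End ℂ X) {m : ℕ} (hm : 1 ≤ m) (V : Submodule ℂ X) :
    V ≤ powSum A m V := by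
  refine le_trans ?_ (le_iSup _ (⟨0, hm⟩ : Fin m))
  simp [Module.End.one_eq_id]

theorem finiteDimensional_powSum (A : Module.End ℂ X) (m : ℕ) (V : Submodule ℂ X)
    [FiniteDimensional ℂ V] : FiniteDimensional ℂ (powSum A m V) := by
  unfold powSum
  infer_instance

theorem map_powSum_le_of_commute {A C : Module.End ℂ X} (hAC : Commute A C) {m : ℕ}
    {V : Submodule ℂ X} (hV : V.map C ≤ V) : (powSum A m V).map C ≤ powSum A m V := by
  unfold powSum
  rw [Submodule.map_iSup]
  refine iSup_mono fun i => ?_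
  rw [← Submodule.map_comp, ← Module.End.mul_eq_comp, ← (hAC.pow_left i).eq,
    Module.End.mul_eq_comp, Submodule.map_comp]
  exact Submodule.map_mono hV

/-- `A` moves each summand to the next one, and the last one goes to `A ^ m V`, which lies in `V`,
the summand of index `0`. -/
theorem map_powSum_le {A : Module.End ℂ X} {m : ℕ} {V : Submodule ℂ X}
    (hV : V.map (A ^ m) ≤ V) : (powSum A m V).map A ≤ powSum A m V := by
  rcases Nat.eq_zero_or_pos m with rfl | hm
  · simp [powSum]
  conv_lhs => unfold powSum
  rw [Submodule.map_iSup]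
  refine iSup_le fun i => ?_
  rw [← Submodule.map_comp, ← Module.End.mul_eq_comp, ← pow_succ']
  rcases Nat.lt_or_ge ((i : ℕ) + 1) m with hi | hi
  · exact le_iSup (fun j : Fin m => V.map (A ^ (j : ℕ))) ⟨i + 1, hi⟩
  · have : (i : ℕ) + 1 = m := by omega
    rw [this]
    exact hV.trans (le_powSum A hm V)

/-- A finite dimensional space invariant under the `m`-th powers of two commuting operators is
contained in a finite dimensional space invariant under both operators. -/
theorem exists_le_map_le {A B : Module.End ℂ X} (hAB : Commute A B) {m : ℕ} (hm : 1 ≤ m)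
    {V : Submodule ℂ X} [FiniteDimensional ℂ V] (hA : V.map (A ^ m) ≤ V)
    (hB : V.map (B ^ m) ≤ V) :
    ∃ W : Submodule ℂ X, FiniteDimensional ℂ W ∧ V ≤ W ∧ W.map A ≤ W ∧ W.map B ≤ W := by
  have := finiteDimensional_powSum A m V
  -- `B ^ m` commutes with `A`, so it still preserves `powSum A m V`; enlarging by powers of `B` in
  -- turn keeps the invariance under `A`.
  refine ⟨powSum B m (powSum A m V), finiteDimensional_powSum _ _ _,
    (le_powSum A hm V).trans (le_powSum B hm _),
    map_powSum_le_of_commute hAB.symm (map_powSum_le hA),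
    map_powSum_le (map_powSum_le_of_commute (hAB.pow_right m) hB)⟩

theorem map_eq_of_map_le {A : Module.End ℂ X} (hA : Function.Injective A) {W : Submodule ℂ X}
    [FiniteDimensional ℂ W] (hW : W.map A ≤ W) : W.map A = W :=
  Submodule.eq_of_le_of_finrank_eq hW (W.equivMapOfInjective A hA).finrank_eq.symm

end Algebra

/-! ### Functionals on complex test functions -/

/-- The complex valued test functions on the real line. -/
abbrev ComplexTestFun : Type := 𝓓((⊤ : TopologicalSpace.Opens ℝ), ℂ)

/-- Translation of complex test functions: `(τ_h φ)(t) = φ (t + h)`. -/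
def translateComplexTest (h : ℝ) : Module.End ℂ ComplexTestFun where
  toFun φ := ⟨fun t => φ (t + h), φ.contDiff.comp (contDiff_id.add contDiff_const),
    φ.hasCompactSupport.comp_homeomorph (Homeomorph.addRight h), fun _ _ => trivial⟩
  map_add' _ _ := rfl
  map_smul' _ _ := rfl

@[simp]
theorem translateComplexTest_apply (h : ℝ) (φ : ComplexTestFun) (t : ℝ) :
    translateComplexTest h φ t = φ (t + h) := rfl

theorem differentiable_complexTest (φ : ComplexTestFun) : Differentiable ℝ φ :=
  φ.contDiff.differentiable (by simp)

/-- The derivative of complex test functions. -/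
def derivComplexTest : Module.End ℂ ComplexTestFun where
  toFun φ := ⟨deriv φ, (contDiff_infty_iff_deriv.1 φ.contDiff).2,
    φ.hasCompactSupport.deriv, fun _ _ => trivial⟩
  map_add' φ ψ := by
    ext t
    exact deriv_add (differentiable_complexTest φ t) (differentiable_complexTest ψ t)
  map_smul' c φ := by
    ext t
    exact deriv_const_smul c (differentiable_complexTest φ t)

@[simp]
theorem derivComplexTest_apply (φ : ComplexTestFun) (t : ℝ) :
    derivComplexTest φ t = deriv φ t := rfl

/-- Translation of functionals: `(τ_h L){φ} = L{τ_{-h} φ}`. -/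
def translateDual (h : ℝ) : Module.End ℂ (Module.Dual ℂ ComplexTestFun) :=
  (translateComplexTest (-h)).dualMap

@[simp]
theorem translateDual_apply (h : ℝ) (L : Module.Dual ℂ ComplexTestFun) (φ : ComplexTestFun) :
    translateDual h L φ = L (translateComplexTest (-h) φ) := rfl

/-- The derivative of functionals: `L'{φ} = -L{φ'}`. -/
def derivDual : Module.End ℂ (Module.Dual ℂ ComplexTestFun) := -derivComplexTest.dualMap

@[simp]
theorem derivDual_apply (L : Module.Dual ℂ ComplexTestFun) (φ : ComplexTestFun) :
    derivDual L φ = -L (derivComplexTest φ) := rfl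

/-- A functional is regular if its translates are differentiable at the origin, with the expected
derivative. -/
def IsRegular (L : Module.Dual ℂ ComplexTestFun) : Prop :=
  ∀ φ : ComplexTestFun, HasDerivAt (fun h : ℝ => translateDual h L φ) (derivDual L φ) 0

theorem translateDual_add (a b : ℝ) (L : Module.Dual ℂ ComplexTestFun) :
    translateDual (a + b) L = translateDual a (translateDual b L) := by
  ext φ
  simp only [translateDual_apply]
  congr 1
  ext t
  simp only [translateComplexTest_apply]
  congr 1
  ring

/-- Regularity speaks of the origin only; the identity `(τ_h L){φ} = (τ_{h-a} L){τ_{-a} φ}` carries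
continuity from the origin to `a`. -/
theorem IsRegular.continuous {L : Module.Dual ℂ ComplexTestFun} (hL : IsRegular L)
    (φ : ComplexTestFun) : Continuous fun h : ℝ => translateDual h L φ := by
  refine continuous_iff_continuousAt.2 fun a => ?_
  have h0 := (hL (translateComplexTest (-a) φ)).continuousAt
  have h1 : (fun h : ℝ => translateDual h L φ) =
      (fun h : ℝ => translateDual h L (translateComplexTest (-a) φ)) ∘ fun h => h - a := by
    ext h
    have := congrArg (fun M => M φ) (translateDual_add a (h - a) L)
    simpa using this
  rw [h1]
  refine ContinuousAt.comp ?_ (by fun_prop)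
  simpa using h0

/-- Pointwise convergence is the product topology on `ComplexTestFun → ℂ`, a Hausdorff vector space
topology, in which finite dimensional subspaces are closed. -/
theorem isClosed_image_coe (W : Submodule ℂ (Module.Dual ℂ ComplexTestFun))
    [FiniteDimensional ℂ W] :
    IsClosed ((fun L : Module.Dual ℂ ComplexTestFun => (L : ComplexTestFun → ℂ)) '' W) :=
  Submodule.closed_of_finiteDimensional
    (W.map (LinearMap.ltoFun ℂ ComplexTestFun ℂ ℂ))

/-- Finite dimensional spaces of functionals are closed under pointwise limits. -/
theorem mem_of_tendsto {ι : Type*} {l : Filter ι} [l.NeBot]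
    {W : Submodule ℂ (Module.Dual ℂ ComplexTestFun)} [FiniteDimensional ℂ W]
    {L : ι → Module.Dual ℂ ComplexTestFun} {M : Module.Dual ℂ ComplexTestFun}
    (hL : ∀ᶠ i in l, L i ∈ W) (hM : ∀ φ, Filter.Tendsto (fun i => L i φ) l (nhds (M φ))) :
    M ∈ W := by
  have h : (M : ComplexTestFun → ℂ) ∈
      (fun L : Module.Dual ℂ ComplexTestFun => (L : ComplexTestFun → ℂ)) '' W :=
    (isClosed_image_coe W).mem_of_tendsto (tendsto_pi_nhds.2 hM)
      (hL.mono fun i hi => ⟨L i, hi, rfl⟩)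
  obtain ⟨N, hN, hNM⟩ := h
  rwa [← DFunLike.coe_injective hNM]

theorem translateDual_zero : translateDual 0 = 1 := by
  ext L φ
  simp only [translateDual_apply, Module.End.one_apply]
  congr 1
  ext t
  simp

/-- A finite dimensional space of regular functionals which is invariant under two incommensurable
translations is translation invariant. -/
theorem translateDual_mem_of_irrational {h₁ h₂ : ℝ} (hirr : Irrational (h₁ / h₂))
    {W : Submodule ℂ (Module.Dual ℂ ComplexTestFun)} [FiniteDimensional ℂ W]
    (hreg : ∀ L ∈ W, IsRegular L) (hW₁ : W.map (translateDual h₁) ≤ W)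
    (hW₂ : W.map (translateDual h₂) ≤ W) (h : ℝ) : W.map (translateDual h) ≤ W := by
  have hadd (a b : ℝ) : translateDual (a + b) = translateDual a * translateDual b := by
    ext1 L
    exact translateDual_add a b L
  have hinj (a : ℝ) : Function.Injective (translateDual a) := by
    refine Function.LeftInverse.injective (g := translateDual (-a)) fun L => ?_
    rw [← translateDual_add, neg_add_cancel, translateDual_zero, Module.End.one_apply]
  -- Equality instead of inclusion makes the stabiliser closed under negation; for `h₁` and `h₂`
  -- equality follows from injectivity and a dimension count.
  let G : AddSubgroup ℝ :=
    { carrier := {a | W.map (translateDual a) = W}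
      zero_mem' := by simp [translateDual_zero, Module.End.one_eq_id]
      add_mem' := by
        intro a b ha hb
        simp only [Set.mem_ofPred_eq] at ha hb ⊢
        rw [hadd, Module.End.mul_eq_comp, Submodule.map_comp, hb, ha]
      neg_mem' := by
        intro a ha
        simp only [Set.mem_ofPred_eq] at ha ⊢
        conv_lhs => rw [← ha]
        rw [← Submodule.map_comp, ← Module.End.mul_eq_comp, ← hadd, neg_add_cancel,
          translateDual_zero, Module.End.one_eq_id, Submodule.map_id] }
  have hG : AddSubgroup.closure {h₁, h₂} ≤ G := by
    rw [AddSubgroup.closure_le]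
    rintro a (rfl | rfl)
    · exact map_eq_of_map_le (hinj _) hW₁
    · exact map_eq_of_map_le (hinj _) hW₂
  have hdense : Dense (G : Set ℝ) := (dense_addSubgroupClosure_pair_iff.2 hirr).mono hG
  rintro _ ⟨L, hL, rfl⟩
  have := mem_closure_iff_nhdsWithin_neBot.1 (hdense h)
  refine mem_of_tendsto (l := nhdsWithin h G) (L := fun a => translateDual a L) ?_ fun φ =>
    ((hreg L hL).continuous φ).continuousAt.continuousWithinAt
  filter_upwards [self_mem_nhdsWithin] with a ha
  have ha' : W.map (translateDual a) = W := ha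
  rw [← ha']
  exact Submodule.mem_map_of_mem hL

/-- A finite dimensional translation invariant space of regular functionals is closed under
differentiation. -/
theorem derivDual_mem {W : Submodule ℂ (Module.Dual ℂ ComplexTestFun)} [FiniteDimensional ℂ W]
    (hreg : ∀ L ∈ W, IsRegular L) (hW : ∀ h, W.map (translateDual h) ≤ W)
    {L : Module.Dual ℂ ComplexTestFun} (hL : L ∈ W) : derivDual L ∈ W := by
  refine mem_of_tendsto (l := nhdsWithin (0 : ℝ) {0}ᶜ)
    (L := fun h => ((h⁻¹ : ℝ) : ℂ) • (translateDual h L - L)) ?_ fun φ => ?_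
  · exact Filter.Eventually.of_forall fun h =>
      W.smul_mem _ (W.sub_mem (hW h (Submodule.mem_map_of_mem hL)) hL)
  · have := (hasDerivAt_iff_tendsto_slope.1 (hreg L hL φ))
    refine this.congr fun h => ?_
    simp [slope, translateDual_zero, Complex.real_smul]

theorem exists_aeval_derivDual_eq_zero {W : Submodule ℂ (Module.Dual ℂ ComplexTestFun)}
    [FiniteDimensional ℂ W] (hW : ∀ L ∈ W, derivDual L ∈ W) :
    ∃ P : ℂ[X], P ≠ 0 ∧ ∀ L ∈ W, aeval derivDual P L = 0 := by
  let D : Module.End ℂ W := derivDual.restrict hW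
  have hD (P : ℂ[X]) (L : W) : ((aeval D P L : W) : Module.Dual ℂ ComplexTestFun) =
      aeval derivDual P (L : Module.Dual ℂ ComplexTestFun) := by
    induction P using Polynomial.induction_on' with
    | add p q hp hq => simp [hp, hq]
    | monomial n a =>
      have hpow : (((D ^ n) L : W) : Module.Dual ℂ ComplexTestFun) = (derivDual ^ n) L := by
        induction n with
        | zero => rfl
        | succ n ih =>
          rw [pow_succ', pow_succ', Module.End.mul_apply, Module.End.mul_apply, ← ih]
          rfl
      simp [aeval_monomial, Module.algebraMap_end_apply, hpow]
  refine ⟨minpoly ℂ D, minpoly.ne_zero (Algebra.IsIntegral.isIntegral D), fun L hL => ?_⟩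
  rw [← hD _ ⟨L, hL⟩]
  exact congrArg Subtype.val (LinearMap.congr_fun (minpoly.aeval ℂ D) ⟨L, hL⟩)

/-! ### Exponential polynomials -/

/-- With `c = μ - l` this solves `G' - l G = p e^{μt}` by `G = q e^{μt}`. For `c = 0` (resonance)
`q` is a primitive of `p`. Otherwise induct on the degree: if `r' + c r = p'`, then `q = c⁻¹ (p -
r)` works. -/
theorem exists_derivative_add_C_mul_eq (c : ℂ) (p : ℂ[X]) :
    ∃ q : ℂ[X], derivative q + C c * q = p := by
  rcases eq_or_ne c 0 with rfl | hc
  · induction p using Polynomial.induction_on' with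
    | add p q hp hq =>
      obtain ⟨p', hp⟩ := hp
      obtain ⟨q', hq⟩ := hq
      exact ⟨p' + q', by simp [← hp, ← hq]⟩
    | monomial n a =>
      refine ⟨monomial (n + 1) (a / (n + 1)), ?_⟩
      have : (n : ℂ) + 1 ≠ 0 := Nat.cast_add_one_ne_zero n
      simp [this]
  · have hC : C c * C c⁻¹ = 1 := by rw [← C_mul, mul_inv_cancel₀ hc, C_1]
    induction hn : p.natDegree using Nat.strong_induction_on generalizing p with
    | _ n ih =>
      rcases Nat.eq_zero_or_pos n with rfl | hpos
      · obtain ⟨a, rfl⟩ := natDegree_eq_zero.1 hn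
        refine ⟨C c⁻¹ * C a, ?_⟩
        rw [← C_mul, derivative_C, C_mul, ← mul_assoc, hC]
        simp
      · obtain ⟨r, hr⟩ := ih _ (hn ▸ natDegree_derivative_lt (by omega)) (derivative p) rfl
        refine ⟨C c⁻¹ * (p - r), ?_⟩
        rw [derivative_C_mul, derivative_sub]
        linear_combination C c⁻¹ * (-hr) + (p - r) * hC + r * hC

theorem IsExpPoly.add {f g : ℝ → ℂ} (hf : IsExpPoly f) (hg : IsExpPoly g) :
    IsExpPoly (f + g) := by
  classical
  obtain ⟨s, p, hp⟩ := hf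
  obtain ⟨s', q, hq⟩ := hg
  -- The values of `p` off `s` and of `q` off `s'` are arbitrary, so they must be cut off before
  -- summing over the union.
  refine ⟨s ∪ s', fun μ => (if μ ∈ s then p μ else 0) + if μ ∈ s' then q μ else 0, fun t => ?_⟩
  simp only [Pi.add_apply, eval_add, add_mul, Finset.sum_add_distrib, hp, hq]
  congr 1
  · rw [← Finset.sum_subset (Finset.subset_union_left (s₂ := s'))]
    · exact Finset.sum_congr rfl fun μ hμ => by simp [hμ]
    · intro μ _ hμ
      simp [hμ]
  · rw [← Finset.sum_subset (Finset.subset_union_right (s₁ := s))]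
    · exact Finset.sum_congr rfl fun μ hμ => by simp [hμ]
    · intro μ _ hμ
      simp [hμ]

theorem isExpPoly_const_mul_exp (c l : ℂ) :
    IsExpPoly fun t : ℝ => c * Complex.exp (l * t) :=
  ⟨{l}, fun _ => C c, fun t => by simp⟩

theorem IsExpPoly.continuous {f : ℝ → ℂ} (hf : IsExpPoly f) : Continuous f := by
  obtain ⟨s, p, hp⟩ := hf
  rw [funext hp]
  fun_prop

/-- The equation `G' - l G = g` has an exponential polynomial solution for every exponential
polynomial `g`. -/
theorem IsExpPoly.exists_hasDerivAt {g : ℝ → ℂ} (hg : IsExpPoly g) (l : ℂ) :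
    ∃ G : ℝ → ℂ, IsExpPoly G ∧ ∀ t, HasDerivAt G (g t + l * G t) t := by
  obtain ⟨s, p, hp⟩ := hg
  choose q hq using fun μ => exists_derivative_add_C_mul_eq (μ - l) (p μ)
  refine ⟨_, ⟨s, q, fun t => rfl⟩, fun t => ?_⟩
  rw [hp, Finset.mul_sum, ← Finset.sum_add_distrib]
  refine HasDerivAt.fun_sum fun μ _ => ?_
  have h1 : HasDerivAt (fun x : ℝ => (q μ).eval (x : ℂ)) ((derivative (q μ)).eval (t : ℂ)) t :=
    ((q μ).hasDerivAt (t : ℂ)).comp_ofReal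
  have h2 : HasDerivAt (fun x : ℝ => Complex.exp (μ * x)) (Complex.exp (μ * t) * (μ * 1)) t :=
    (((hasDerivAt_id (t : ℂ)).const_mul μ).cexp).comp_ofReal
  refine (h1.fun_mul h2).congr_deriv ?_
  rw [← hq μ]
  simp only [eval_add, eval_mul, eval_C]
  ring

/-! ### The functional of a continuous function -/

theorem integrable_complexTest_mul (φ : ComplexTestFun) {f : ℝ → ℂ} (hf : Continuous f) :
    Integrable fun t => φ t * f t :=
  (φ.continuous.mul hf).integrable_of_hasCompactSupport φ.hasCompactSupport.mul_right

/-- The functional `φ ↦ ∫ φ f` of a continuous function `f`. -/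
def integralDual (f : ℝ → ℂ) (hf : Continuous f) : Module.Dual ℂ ComplexTestFun where
  toFun φ := ∫ t, φ t * f t
  map_add' φ ψ := by
    rw [← integral_add (integrable_complexTest_mul φ hf) (integrable_complexTest_mul ψ hf)]
    refine integral_congr_ae (Filter.Eventually.of_forall fun t => ?_)
    exact add_mul (φ t) (ψ t) (f t)
  map_smul' c φ := by
    rw [RingHom.id_apply, smul_eq_mul, ← integral_const_mul]
    refine integral_congr_ae (Filter.Eventually.of_forall fun t => ?_)
    exact mul_assoc c (φ t) (f t)

@[simp]
theorem integralDual_apply (f : ℝ → ℂ) (hf : Continuous f) (φ : ComplexTestFun) :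
    integralDual f hf φ = ∫ t, φ t * f t := rfl

/-- Integration by parts: if `G' - l G = g` then `∫ (φ' + l φ) G = -∫ φ g`. -/
theorem integral_deriv_add_mul_eq (φ : ComplexTestFun) {l : ℂ} {g G : ℝ → ℂ} (hg : Continuous g)
    (hG : ∀ t, HasDerivAt G (g t + l * G t) t) :
    ∫ t, (derivComplexTest φ + l • φ) t * G t = -∫ t, φ t * g t := by
  have hGc : Continuous G := continuous_iff_continuousAt.2 fun t => (hG t).continuousAt
  have h1 := integrable_complexTest_mul (derivComplexTest φ + l • φ) hGc
  have h2 := integrable_complexTest_mul φ hg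
  have h3 : ∀ t, HasDerivAt (fun t => φ t * G t)
      ((derivComplexTest φ + l • φ) t * G t + φ t * g t) t := fun t => by
    refine ((differentiable_complexTest φ t).hasDerivAt.fun_mul (hG t)).congr_deriv ?_
    change _ = (deriv φ t + l * φ t) * G t + φ t * g t
    ring
  have h4 := integral_eq_zero_of_hasDerivAt_of_integrable h3 (h1.add h2)
    (integrable_complexTest_mul φ hGc)
  rw [integral_add h1 h2] at h4
  exact eq_neg_of_add_eq_zero_left h4

/-- A test function `φ` with `∫ φ(t) e^{lt} dt = 0` is of the form `ψ' + l ψ`. -/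
theorem exists_deriv_add_smul_eq (φ : ComplexTestFun) (l : ℂ)
    (hφ : ∫ t : ℝ, φ t * Complex.exp (l * t) = 0) :
    ∃ ψ : ComplexTestFun, derivComplexTest ψ + l • ψ = φ := by
  obtain ⟨R, hR0, hR⟩ : ∃ R : ℝ, 0 < R ∧ ∀ t, R < |t| → φ t = 0 := by
    obtain ⟨R, hR⟩ := φ.hasCompactSupport.isCompact.isBounded.subset_closedBall (0 : ℝ)
    refine ⟨max R 1, by positivity, fun t ht => ?_⟩
    by_contra h
    have := hR (subset_tsupport _ h)
    rw [Metric.mem_closedBall, Real.dist_eq, sub_zero] at this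
    exact absurd (le_max_left R 1) (by linarith)
  let u : ℝ → ℂ := fun t => φ t * Complex.exp (l * t)
  have hexp (c : ℂ) : ContDiff ℝ (⊤ : ℕ∞) fun t : ℝ => Complex.exp (c * t) :=
    (contDiff_const.mul Complex.ofRealCLM.contDiff).cexp
  have hu : ContDiff ℝ (⊤ : ℕ∞) u := φ.contDiff.mul (hexp l)
  have hu0 (t : ℝ) (ht : R < |t|) : u t = 0 := by simp [u, hR t ht]
  -- The integrating factor turns `ψ' + l ψ = φ` into `(e^{lt} ψ)' = e^{lt} φ`, so `ψ = e^{-lt} U`.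
  -- The vanishing of the full integral gives `U = 0` to the right of `R`, hence compact support.
  let U : ℝ → ℂ := fun t => ∫ s in (-R)..t, u s
  have hU (t : ℝ) : HasDerivAt U (u t) t :=
    intervalIntegral.integral_hasDerivAt_right (hu.continuous.intervalIntegrable _ _)
      hu.continuous.aestronglyMeasurable.stronglyMeasurableAtFilter hu.continuous.continuousAt
  have hUc : ContDiff ℝ (⊤ : ℕ∞) U := by
    rw [contDiff_infty_iff_deriv]
    refine ⟨fun t => (hU t).differentiableAt, ?_⟩
    rwa [show deriv U = u from funext fun t => (hU t).deriv]
  have hU0 (t : ℝ) (ht : R < |t|) : U t = 0 := by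
    rcases lt_abs.1 ht with h | h
    · have : ∫ s, u s = U t := by
        simp only [U]
        rw [intervalIntegral.integral_of_le (by linarith)]
        refine (setIntegral_eq_integral_of_ae_compl_eq_zero ?_).symm
        have : ∀ᵐ s : ℝ, s ≠ -R := by simp [ae_iff, measure_singleton]
        filter_upwards [this] with s hs hs'
        refine hu0 s ?_
        rw [Set.mem_Ioc, not_and_or, not_lt, not_le] at hs'
        rcases hs' with h' | h'
        · exact lt_abs.2 (Or.inr (by linarith [lt_of_le_of_ne h' hs]))
        · exact lt_abs.2 (Or.inl (by linarith))
      rw [← this, hφ]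
    · refine intervalIntegral.integral_zero_ae ?_
      refine Filter.Eventually.of_forall fun s hs => ?_
      rw [Set.uIoc_of_ge (by linarith)] at hs
      have : ∀ s, s < -R → u s = 0 := fun s hs => hu0 s (lt_abs.2 (Or.inr (by linarith)))
      rcases lt_or_eq_of_le hs.2 with h' | rfl
      · exact this s h'
      -- The choice of `R` gives zeros only for `R < |s|`; the endpoint `-R` is reached by
      -- continuity.
      · have hcl : closure (Set.Iio (-R)) ⊆ {s | u s = 0} :=
          closure_minimal this (isClosed_singleton.preimage hu.continuous)
        exact hcl (by simp [closure_Iio])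
  let ψ : ComplexTestFun := ⟨fun t => Complex.exp (-l * t) * U t, (hexp (-l)).mul hUc, by
    refine HasCompactSupport.of_support_subset_isCompact (isCompact_Icc (a := -R) (b := R)) ?_
    intro t ht
    rw [Set.mem_Icc, ← abs_le]
    by_contra h
    exact ht (by simp [hU0 t (not_le.1 h)]), fun _ _ => trivial⟩
  refine ⟨ψ, ?_⟩
  ext t
  have h1 : HasDerivAt (fun x : ℝ => Complex.exp (-l * x)) (Complex.exp (-l * t) * (-l * 1)) t :=
    (((hasDerivAt_id (t : ℂ)).const_mul (-l)).cexp).comp_ofReal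
  change deriv (fun t : ℝ => Complex.exp (-l * t) * U t) t + l * (Complex.exp (-l * t) * U t) = φ t
  rw [(h1.fun_mul (hU t)).deriv]
  have h2 : Complex.exp (-l * t) * Complex.exp (l * t) = 1 := by
    rw [← Complex.exp_add]; simp
  simp only [u]
  linear_combination φ t * h2

theorem exists_integral_mul_exp_ne_zero (l : ℂ) :
    ∃ φ : ComplexTestFun, ∫ t : ℝ, φ t * Complex.exp (l * t) ≠ 0 := by
  let b : ContDiffBump (0 : ℝ) := default
  refine ⟨⟨fun t => (b t : ℂ) * Complex.exp (-l * t),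
    (Complex.ofRealCLM.contDiff.comp b.contDiff).mul
      (contDiff_const.mul Complex.ofRealCLM.contDiff).cexp,
    (b.hasCompactSupport.comp_left Complex.ofReal_zero).mul_right, fun _ _ => trivial⟩, ?_⟩
  have : ∫ t : ℝ, ((b t : ℂ) * Complex.exp (-l * t)) * Complex.exp (l * t) =
      ((∫ t, b t : ℝ) : ℂ) := by
    rw [← integral_complex_ofReal]
    refine integral_congr_ae (Filter.Eventually.of_forall fun t => ?_)
    simp only [mul_assoc, ← Complex.exp_add]
    simp
  refine ne_of_eq_of_ne this ?_
  exact_mod_cast b.integral_pos.ne'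

/-- A functional killing all test functions `φ' + l φ` is a multiple of `φ ↦ ∫ φ(t) e^{lt} dt`. -/
theorem exists_eq_const_mul_integral {L : Module.Dual ℂ ComplexTestFun} {l : ℂ}
    (hL : ∀ φ, L (derivComplexTest φ + l • φ) = 0) :
    ∃ c : ℂ, ∀ φ, L φ = c * ∫ t : ℝ, φ t * Complex.exp (l * t) := by
  obtain ⟨φ₀, hφ₀⟩ := exists_integral_mul_exp_ne_zero l
  let E := integralDual (fun t : ℝ => Complex.exp (l * t)) (by fun_prop)
  have hE (φ : ComplexTestFun) : ∫ t : ℝ, φ t * Complex.exp (l * t) = E φ := rfl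
  rw [hE] at hφ₀
  refine ⟨L φ₀ / E φ₀, fun φ => ?_⟩
  rw [hE]
  have h0 : E (φ - (E φ / E φ₀) • φ₀) = 0 := by
    rw [map_sub, map_smul, smul_eq_mul, div_mul_cancel₀ _ hφ₀, sub_self]
  obtain ⟨ψ, hψ⟩ := exists_deriv_add_smul_eq _ l h0
  have h1 := hL ψ
  rw [hψ, map_sub, map_smul, smul_eq_mul, sub_eq_zero] at h1
  rw [h1]
  ring

/-- A functional is an exponential polynomial if it is `φ ↦ ∫ φ f` for an exponential polynomial
`f`. -/
def IsExpPolyDual (L : Module.Dual ℂ ComplexTestFun) : Prop :=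
  ∃ f : ℝ → ℂ, IsExpPoly f ∧ ∀ φ : ComplexTestFun, L φ = ∫ t, φ t * f t

/-- Subtracting a classical exponential polynomial solution `G` of `G' - l G = g` leaves a weak
solution of the homogeneous equation, which is a multiple of `e^{lt}`. -/
theorem IsExpPolyDual.of_derivDual_sub {L : Module.Dual ℂ ComplexTestFun} {l : ℂ}
    (h : IsExpPolyDual (derivDual L - l • L)) : IsExpPolyDual L := by
  obtain ⟨g, hg, hLg⟩ := h
  obtain ⟨G, hG, hGd⟩ := hg.exists_hasDerivAt l
  have hM (φ : ComplexTestFun) :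
      (L - integralDual G hG.continuous) (derivComplexTest φ + l • φ) = 0 := by
    have h1 := hLg φ
    rw [LinearMap.sub_apply, derivDual_apply, LinearMap.smul_apply, smul_eq_mul] at h1
    rw [LinearMap.sub_apply, integralDual_apply, integral_deriv_add_mul_eq φ hg.continuous hGd,
      map_add, map_smul, smul_eq_mul, ← h1]
    ring
  obtain ⟨c, hc⟩ := exists_eq_const_mul_integral hM
  have hexp := isExpPoly_const_mul_exp c l
  refine ⟨_, hG.add hexp, fun φ => ?_⟩
  have h2 := hc φ
  rw [LinearMap.sub_apply, sub_eq_iff_eq_add, integralDual_apply, ← integral_const_mul] at h2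
  rw [h2, add_comm, ← integral_add (integrable_complexTest_mul φ hG.continuous)
    (((integrable_complexTest_mul φ (by fun_prop)).const_mul c))]
  refine integral_congr_ae (Filter.Eventually.of_forall fun t => ?_)
  simp only [Pi.add_apply]
  ring

theorem isExpPolyDual_of_aeval_eq_zero {P : ℂ[X]} (hP : P ≠ 0)
    {L : Module.Dual ℂ ComplexTestFun} (hL : aeval derivDual P L = 0) : IsExpPolyDual L := by
  induction hn : P.natDegree generalizing P L with
  | zero =>
    obtain ⟨a, rfl⟩ := natDegree_eq_zero.1 hn
    have ha : a ≠ 0 := fun h => hP (by simp [h])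
    have hL0 : L = 0 := by
      simpa [Module.algebraMap_end_apply, ha] using hL
    exact ⟨fun _ => 0, ⟨∅, 0, fun _ => by simp⟩, fun φ => by simp [hL0]⟩
  | succ n ih =>
    obtain ⟨l, hl⟩ := IsAlgClosed.exists_root P
      (fun h => by have := natDegree_eq_zero_iff_degree_le_zero.2 h.le; omega)
    obtain ⟨Q, rfl⟩ := dvd_iff_isRoot.2 hl
    have hQ : Q ≠ 0 := right_ne_zero_of_mul hP
    rw [natDegree_mul (X_sub_C_ne_zero l) hQ, natDegree_X_sub_C] at hn
    refine IsExpPolyDual.of_derivDual_sub (l := l) (ih hQ ?_ (by omega))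
    -- The factor `X - l` is applied to `L` first, so that `Q` annihilates `L' - l L` and the
    -- induction hypothesis applies.
    rw [mul_comm, map_mul, Module.End.mul_apply] at hL
    simpa [Module.algebraMap_end_apply] using hL

/-! ### The abstract theorem -/

/-- The theorem for a space `X` with translations `τ` which embeds equivariantly into the regular
functionals on test functions. -/
theorem exists_translationInvariant_of_embedding {X : Type*} [AddCommGroup X] [Module ℂ X]
    {τ : ℝ → Module.End ℂ X} (ι : X →ₗ[ℂ] Module.Dual ℂ ComplexTestFun)
    (hι : Function.Injective ι) (hτ : ∀ h x, ι (τ h x) = translateDual h (ι x))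
    (hreg : ∀ x, IsRegular (ι x)) {m : ℕ} (hm : 1 ≤ m) {h₁ h₂ : ℝ}
    (hirr : Irrational (h₁ / h₂)) {V : Submodule ℂ X} [FiniteDimensional ℂ V]
    (hV₁ : V.map (difference τ h₁ ^ m) ≤ V) (hV₂ : V.map (difference τ h₂ ^ m) ≤ V) :
    (∃ W : Submodule ℂ X, FiniteDimensional ℂ W ∧ TranslationInvariant τ W ∧ V ≤ W) ∧
      ∀ x ∈ V, IsExpPolyDual (ι x) := by
  have hcomm : Commute (difference τ h₁) (difference τ h₂) := by
    have h : Commute (τ h₁) (τ h₂) := by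
      refine LinearMap.ext fun x => hι ?_
      simp only [Module.End.mul_apply, hτ]
      rw [← translateDual_add, add_comm, translateDual_add]
    exact (h.sub_left (Commute.one_left _)).sub_right (Commute.one_right _)
  obtain ⟨W, hWfin, hVW, hW₁, hW₂⟩ := exists_le_map_le hcomm hm hV₁ hV₂
  have hτW (h : ℝ) (hW : W.map (difference τ h) ≤ W) :
      (W.map ι).map (translateDual h) ≤ W.map ι := by
    rintro _ ⟨_, ⟨x, hx, rfl⟩, rfl⟩
    -- `τ_h = Δ_h + 1`.
    refine ⟨τ h x, ?_, hτ h x⟩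
    have := W.add_mem (hW (Submodule.mem_map_of_mem hx)) hx
    simpa [difference] using this
  have hWreg : ∀ L ∈ W.map ι, IsRegular L := by
    rintro _ ⟨x, -, rfl⟩
    exact hreg x
  have hinv := translateDual_mem_of_irrational hirr hWreg (hτW h₁ hW₁) (hτW h₂ hW₂)
  refine ⟨⟨W, hWfin, ?_, hVW⟩, fun x hx => ?_⟩
  · rintro h _ ⟨x, hx, rfl⟩
    obtain ⟨y, hy, hxy⟩ := hinv h (Submodule.mem_map_of_mem (Submodule.mem_map_of_mem hx))
    rw [← hτ] at hxy
    rwa [← hι hxy]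
  · obtain ⟨P, hP, hPW⟩ := exists_aeval_derivDual_eq_zero (W := W.map ι)
      fun L hL => derivDual_mem hWreg hinv hL
    exact isExpPolyDual_of_aeval_eq_zero hP (hPW _ (Submodule.mem_map_of_mem (hVW hx)))

/-! ### Continuous functions as functionals -/

/-- A real test function as a complex one. -/
def ofRealTest (φ : TestFun) : ComplexTestFun :=
  ⟨fun t => (φ t : ℂ), Complex.ofRealCLM.contDiff.comp φ.contDiff,
    φ.hasCompactSupport.comp_left Complex.ofReal_zero, fun _ _ => trivial⟩

/-- The embedding `f ↦ (φ ↦ ∫ φ f)` of the continuous functions into the functionals. -/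
def continuousMapToDual : C(ℝ, ℂ) →ₗ[ℂ] Module.Dual ℂ ComplexTestFun where
  toFun f := integralDual f f.continuous
  map_add' f g := by
    ext φ
    simp only [integralDual_apply, LinearMap.add_apply, ContinuousMap.add_apply, mul_add]
    exact integral_add (integrable_complexTest_mul φ f.continuous)
      (integrable_complexTest_mul φ g.continuous)
  map_smul' c f := by
    ext φ
    simp only [integralDual_apply, LinearMap.smul_apply, ContinuousMap.smul_apply, smul_eq_mul,
      RingHom.id_apply, ← integral_const_mul]
    exact integral_congr_ae (Filter.Eventually.of_forall fun t => mul_left_comm _ _ _)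

theorem continuousMapToDual_apply (f : C(ℝ, ℂ)) (φ : ComplexTestFun) :
    continuousMapToDual f φ = ∫ t, φ t * f t := rfl

theorem continuousMapToDual_injective : Function.Injective continuousMapToDual := by
  rw [← LinearMap.ker_eq_bot, LinearMap.ker_eq_bot']
  intro f hf
  have h : ∀ᵐ t : ℝ, f t = 0 := by
    refine ae_eq_zero_of_integral_contDiff_smul_eq_zero f.continuous.locallyIntegrable ?_
    intro g hg hgc
    have := LinearMap.congr_fun hf (ofRealTest ⟨g, hg, hgc, fun _ _ => trivial⟩)
    exact (integral_congr_ae (Filter.Eventually.of_forall fun t =>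
      Complex.real_smul (x := g t))).trans this
  ext t
  exact congrFun ((f.continuous.ae_eq_iff_eq volume continuous_const).1 h) t

theorem continuousMapToDual_translateFun (h : ℝ) (f : C(ℝ, ℂ)) :
    continuousMapToDual (translateFun h f) = translateDual h (continuousMapToDual f) := by
  ext φ
  rw [translateDual_apply, continuousMapToDual_apply, continuousMapToDual_apply,
    ← integral_add_right_eq_self (fun t => translateComplexTest (-h) φ t * f t) h]
  refine integral_congr_ae (Filter.Eventually.of_forall fun t => ?_)
  simp [translateFun]

/-- `h ↦ ∫ φ(t - h) f(t) dt` is the convolution of `f` with the reflected test function `φ(-·)`, so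
the derivative falls on the smooth factor. -/
theorem isRegular_continuousMapToDual (f : C(ℝ, ℂ)) : IsRegular (continuousMapToDual f) := by
  intro φ
  have hg : ContDiff ℝ 1 fun t => φ (-t) := (φ.contDiff.of_le (by simp)).comp contDiff_neg
  have hgc : HasCompactSupport fun t => φ (-t) :=
    φ.hasCompactSupport.comp_homeomorph (Homeomorph.neg ℝ)
  have h := hgc.hasDerivAt_convolution_right (ContinuousLinearMap.mul ℝ ℂ)
    (f.continuous.locallyIntegrable (μ := volume)) hg 0
  have hd : deriv (fun t => φ (-t)) = fun t => -deriv φ (-t) := funext fun t =>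
    deriv_comp_neg _ _
  rw [hd] at h
  refine (h.congr_deriv ?_).congr_of_eventuallyEq (Filter.Eventually.of_forall fun x => ?_)
  · rw [derivDual_apply, continuousMapToDual_apply, ← integral_neg]
    refine integral_congr_ae (Filter.Eventually.of_forall fun t => ?_)
    simp [mul_comm]
  · simp only [translateDual_apply, continuousMapToDual_apply]
    refine integral_congr_ae (Filter.Eventually.of_forall fun t => ?_)
    simp [mul_comm, sub_eq_add_neg]

/-! ### Distributions as functionals -/

/-- The real part of a complex test function. -/
def reTest (φ : ComplexTestFun) : TestFun :=
  ⟨fun t => (φ t).re, Complex.reCLM.contDiff.comp φ.contDiff,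
    φ.hasCompactSupport.comp_left Complex.zero_re, fun _ _ => trivial⟩

/-- The imaginary part of a complex test function. -/
def imTest (φ : ComplexTestFun) : TestFun :=
  ⟨fun t => (φ t).im, Complex.imCLM.contDiff.comp φ.contDiff,
    φ.hasCompactSupport.comp_left Complex.zero_im, fun _ _ => trivial⟩

theorem reTest_add (φ ψ : ComplexTestFun) : reTest (φ + ψ) = reTest φ + reTest ψ := rfl

theorem imTest_add (φ ψ : ComplexTestFun) : imTest (φ + ψ) = imTest φ + imTest ψ := rfl

theorem reTest_smul (c : ℂ) (φ : ComplexTestFun) :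
    reTest (c • φ) = c.re • reTest φ - c.im • imTest φ := by
  ext t
  exact Complex.mul_re c (φ t)

theorem imTest_smul (c : ℂ) (φ : ComplexTestFun) :
    imTest (c • φ) = c.re • imTest φ + c.im • reTest φ := by
  ext t
  exact Complex.mul_im c (φ t)

/-- The complex linear extension of distributions to complex test functions. -/
def distributionToDual : ComplexDistribution →ₗ[ℂ] Module.Dual ℂ ComplexTestFun where
  toFun T :=
    { toFun := fun φ => T (reTest φ) + Complex.I * T (imTest φ)
      map_add' := fun φ ψ => by
        rw [reTest_add, imTest_add, map_add, map_add]
        ring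
      map_smul' := fun c φ => by
        rw [reTest_smul, imTest_smul, map_add, map_sub, map_smul, map_smul, map_smul, map_smul]
        simp only [Complex.real_smul, RingHom.id_apply, smul_eq_mul]
        conv_rhs => rw [← Complex.re_add_im c]
        linear_combination (-(c.im : ℂ) * T (imTest φ)) * Complex.I_sq }
  map_add' S T := by
    ext φ
    change (S (reTest φ) + T (reTest φ)) + Complex.I * (S (imTest φ) + T (imTest φ)) =
      (S (reTest φ) + Complex.I * S (imTest φ)) + (T (reTest φ) + Complex.I * T (imTest φ))
    ring
  map_smul' c T := by
    ext φ
    change c * T (reTest φ) + Complex.I * (c * T (imTest φ)) =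
      c * (T (reTest φ) + Complex.I * T (imTest φ))
    ring

theorem distributionToDual_apply (T : ComplexDistribution) (φ : ComplexTestFun) :
    distributionToDual T φ = T (reTest φ) + Complex.I * T (imTest φ) := rfl

theorem distributionToDual_ofRealTest (T : ComplexDistribution) (φ : TestFun) :
    distributionToDual T (ofRealTest φ) = T φ := by
  have h1 : reTest (ofRealTest φ) = φ := rfl
  have h2 : imTest (ofRealTest φ) = 0 := rfl
  rw [distributionToDual_apply, h1, h2, map_zero, mul_zero, add_zero]

theorem distributionToDual_injective : Function.Injective distributionToDual := by
  intro S T h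
  refine DFunLike.ext _ _ fun φ => ?_
  rw [← distributionToDual_ofRealTest, h, distributionToDual_ofRealTest]

theorem distributionToDual_translateDistribution (h : ℝ) (T : ComplexDistribution) :
    distributionToDual (translateDistribution h T) = translateDual h (distributionToDual T) :=
  rfl

/-- The derivative of real test functions. -/
def derivTest (φ : TestFun) : TestFun :=
  ⟨deriv φ, (contDiff_infty_iff_deriv.1 φ.contDiff).2, φ.hasCompactSupport.deriv,
    fun _ _ => trivial⟩

/-- Taylor's formula of order one with a uniform bound of the remainder. -/
theorem abs_sub_add_mul_deriv_le {g : ℝ → ℝ} (hg : ContDiff ℝ 2 g) {C : ℝ}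
    (hC : ∀ t, |deriv (deriv g) t| ≤ C) (t h : ℝ) :
    |g (t - h) - g t + h * deriv g t| ≤ C * |h| * |h| := by
  have hC0 : 0 ≤ C := (abs_nonneg _).trans (hC 0)
  have hg1 : Differentiable ℝ g := hg.differentiable (by simp)
  have hg' : ContDiff ℝ 1 (deriv g) := (contDiff_succ_iff_deriv (n := 1).1 hg).2.2
  have hLip (x y : ℝ) : |deriv g y - deriv g x| ≤ C * |y - x| :=
    convex_univ.norm_image_sub_le_of_norm_deriv_le
      (fun z _ => (hg'.differentiable (by simp)) z) (fun z _ => hC z) trivial trivial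
  -- `k' (s) = g' (t) - g' (t - s)` is at most `C |s| ≤ C |h|` in absolute value between `0` and
  -- `h`; the mean value inequality for `k` gives the bound.
  let k : ℝ → ℝ := fun s => g (t - s) + s * deriv g t
  have hk (s : ℝ) : HasDerivAt k (-deriv g (t - s) + deriv g t) s := by
    have h1 : HasDerivAt (fun s => g (t - s)) (-deriv g (t - s)) s := by
      simpa using (hg1 (t - s)).hasDerivAt.comp_const_sub t s
    simpa using h1.fun_add ((hasDerivAt_id s).mul_const (deriv g t))
  have hmv := (convex_uIcc 0 h).norm_image_sub_le_of_norm_hasDerivWithin_le (f := k)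
    (C := C * |h|) (fun s _ => (hk s).hasDerivWithinAt) (fun s hs => by
      rw [neg_add_eq_sub, Real.norm_eq_abs]
      refine (hLip (t - s) t).trans ?_
      rw [sub_sub_cancel]
      have := Set.abs_sub_left_of_mem_uIcc hs
      simp only [sub_zero] at this
      gcongr) Set.left_mem_uIcc Set.right_mem_uIcc
  simp only [k, Real.norm_eq_abs, sub_zero, zero_mul, add_zero] at hmv
  rwa [show g (t - h) - g t + h * deriv g t = g (t - h) + h * deriv g t - g t by ring]

theorem coe_iterate_derivTest (φ : TestFun) (i : ℕ) :
    ⇑(derivTest^[i] φ) = iteratedDeriv i φ := by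
  induction i with
  | zero => rw [iteratedDeriv_zero]; rfl
  | succ i ih =>
    rw [Function.iterate_succ_apply', iteratedDeriv_succ, ← ih]
    rfl

/-- Derivatives commute with difference quotients, so the Taylor bound applied to the `i`-th
derivative of `φ` controls the `i`-th seminorm. -/
theorem iteratedDeriv_difference_quotient (φ : TestFun) (i : ℕ) (h t : ℝ) :
    iteratedDeriv i (fun t => h⁻¹ * (φ (t + -h) - φ t) + deriv φ t) t =
      h⁻¹ * (iteratedDeriv i φ (t - h) - iteratedDeriv i φ t) + deriv (iteratedDeriv i φ) t := by
  have hi : ((i : ℕ∞) : WithTop ℕ∞) ≤ ((⊤ : ℕ∞) : WithTop ℕ∞) := WithTop.coe_le_coe.2 le_top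
  have h1 : ContDiffAt ℝ i (fun t => φ (t + -h)) t :=
    ((translateTest (-h) φ).contDiff.of_le hi).contDiffAt
  have h2 : ContDiffAt ℝ i φ t := (φ.contDiff.of_le hi).contDiffAt
  have h3 : ContDiffAt ℝ i (deriv φ) t := ((derivTest φ).contDiff.of_le hi).contDiffAt
  rw [iteratedDeriv_fun_add (contDiffAt_const.mul (h1.sub h2)) h3,
    iteratedDeriv_const_mul_field, iteratedDeriv_fun_sub h1 h2,
    iteratedDeriv_comp_add_const, ← iteratedDeriv_succ', iteratedDeriv_succ]
  rfl

/-- The difference quotients of a test function converge to its derivative, for every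
distribution. -/
theorem hasDerivAt_distribution_translateTest (T : ComplexDistribution) (φ : TestFun) :
    HasDerivAt (fun h : ℝ => T (translateTest (-h) φ)) (-T (derivTest φ)) 0 := by
  -- For `|h| ≤ 1` all difference quotients are supported in this one compact set, so convergence
  -- can be checked in `𝓓^{⊤}_{K}(ℝ, ℝ)`, seminorm by seminorm. The value `0` of `q` for other `h`
  -- is irrelevant to the limit.
  let K : TopologicalSpace.Compacts ℝ :=
    ⟨Metric.cthickening 1 (tsupport φ), φ.hasCompactSupport.isCompact.cthickening⟩
  have hK0 (t : ℝ) (ht : t ∉ K) : φ t = 0 := by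
    by_contra h
    exact ht (Metric.self_subset_cthickening _ (subset_tsupport _ h))
  have hKh (t h : ℝ) (hh : |h| ≤ 1) (ht : t ∉ K) : φ (t + -h) = 0 := by
    by_contra h'
    refine ht (Metric.mem_cthickening_of_dist_le t (t + -h) 1 _ (subset_tsupport _ h') ?_)
    simpa [Real.dist_eq] using hh
  have hKd (t : ℝ) (ht : t ∉ K) : deriv φ t = 0 := by
    by_contra h
    exact ht (Metric.self_subset_cthickening _ (support_deriv_subset h))
  let q : ℝ → 𝓓^{⊤}_{K}(ℝ, ℝ) := fun h => if hh : |h| ≤ 1 then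
    ⟨fun t => h⁻¹ * (φ (t + -h) - φ t),
      contDiff_const.mul ((translateTest (-h) φ).contDiff.sub φ.contDiff),
      fun t ht => by simp [hKh t h hh ht, hK0 t ht]⟩ else 0
  let d : 𝓓^{⊤}_{K}(ℝ, ℝ) := ⟨fun t => -deriv φ t, (derivTest φ).contDiff.neg,
    fun t ht => by simp [hKd t ht]⟩
  have hTc : Continuous fun ψ : 𝓓^{⊤}_{K}(ℝ, ℝ) =>
      T (TestFunction.ofSupportedIn (fun _ _ => trivial) ψ) :=
    T.continuous.comp (TestFunction.continuous_ofSupportedIn _)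
  have hlim : Filter.Tendsto q (nhdsWithin 0 {0}ᶜ) (nhds d) := by
    rw [(ContDiffMapSupportedIn.withSeminorms ℝ ℝ ℝ ⊤ K).tendsto_nhds]
    intro i ε hε
    have hgs : ContDiff ℝ (⊤ : ℕ∞) (iteratedDeriv i φ) := by
      rw [← coe_iterate_derivTest]
      exact (derivTest^[i] φ).contDiff
    obtain ⟨C, hC0, hC⟩ : ∃ C : ℝ, 0 ≤ C ∧ ∀ t, |deriv (deriv (iteratedDeriv i φ)) t| ≤ C := by
      rw [← iteratedDeriv_succ, ← iteratedDeriv_succ, ← coe_iterate_derivTest]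
      obtain ⟨C, hC⟩ := (derivTest^[i + 1 + 1] φ).hasCompactSupport.exists_bound_of_continuous
        (derivTest^[i + 1 + 1] φ).continuous
      exact ⟨C, (norm_nonneg _).trans (hC 0), hC⟩
    have hball : ∀ᶠ h : ℝ in nhdsWithin 0 {0}ᶜ, h ≠ 0 ∧ |h| ≤ 1 ∧ C * |h| < ε := by
      refine Filter.Eventually.and self_mem_nhdsWithin
        (Filter.Eventually.filter_mono nhdsWithin_le_nhds (Filter.Eventually.and ?_ ?_))
      · exact (continuous_abs.tendsto' (0 : ℝ) 0 abs_zero).eventually_le_const one_pos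
      · exact ((continuous_const.mul continuous_abs).tendsto' (0 : ℝ) 0
          (by simp)).eventually_lt_const hε
    filter_upwards [hball] with h ⟨h0, hh, hlt⟩
    refine lt_of_le_of_lt ?_ hlt
    rw [ContDiffMapSupportedIn.seminorm_top_le_iff ℝ (by positivity)]
    intro t _
    have hfun : ⇑(q h - d) = fun t => h⁻¹ * (φ (t + -h) - φ t) + deriv φ t := by
      ext t
      change q h t - -deriv φ t = _
      simp only [q, dif_pos hh, sub_neg_eq_add]
      rfl
    rw [norm_iteratedFDeriv_eq_norm_iteratedDeriv, hfun, iteratedDeriv_difference_quotient φ,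
      Real.norm_eq_abs]
    have hT := abs_sub_add_mul_deriv_le (hgs.of_le (by norm_cast)) hC t h
    have : h⁻¹ * (iteratedDeriv i φ (t - h) - iteratedDeriv i φ t) + deriv (iteratedDeriv i φ) t =
        h⁻¹ * (iteratedDeriv i φ (t - h) - iteratedDeriv i φ t +
          h * deriv (iteratedDeriv i φ) t) := by
      field_simp
    rw [this, abs_mul, abs_inv, inv_mul_le_iff₀ (abs_pos.2 h0)]
    linarith
  have hd : T (TestFunction.ofSupportedIn (fun _ _ => trivial) d) = -T (derivTest φ) := by
    rw [← map_neg]; rfl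
  rw [hasDerivAt_iff_tendsto_slope, ← hd]
  refine ((hTc.tendsto d).comp hlim).congr' ?_
  have h1 : ∀ᶠ h : ℝ in nhdsWithin 0 {0}ᶜ, |h| ≤ 1 := by
    refine Filter.Eventually.filter_mono nhdsWithin_le_nhds ?_
    filter_upwards [Metric.closedBall_mem_nhds (0 : ℝ) one_pos] with h hh
    simpa [Real.dist_eq] using hh
  filter_upwards [h1] with h hh
  have hq : (TestFunction.ofSupportedIn (fun _ _ => trivial) (q h) : TestFun) =
      h⁻¹ • (translateTest (-h) φ - translateTest (-0) φ) := by
    ext t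
    change q h t = h⁻¹ * (φ (t + -h) - φ (t + -0))
    simp only [q, dif_pos hh, neg_zero, add_zero]
    rfl
  simp only [Function.comp_apply, slope, vsub_eq_sub, sub_zero]
  rw [hq, map_smul, map_sub]

theorem isRegular_distributionToDual (T : ComplexDistribution) :
    IsRegular (distributionToDual T) := by
  intro φ
  have h1 := hasDerivAt_distribution_translateTest T (reTest φ)
  have h2 := hasDerivAt_distribution_translateTest T (imTest φ)
  have hre : derivTest (reTest φ) = reTest (derivComplexTest φ) := by
    ext t
    exact (Complex.reCLM.hasFDerivAt.comp_hasDerivAt t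
      (differentiable_complexTest φ t).hasDerivAt).deriv
  have him : derivTest (imTest φ) = imTest (derivComplexTest φ) := by
    ext t
    exact (Complex.imCLM.hasFDerivAt.comp_hasDerivAt t
      (differentiable_complexTest φ t).hasDerivAt).deriv
  rw [hre] at h1
  rw [him] at h2
  refine (h1.fun_add (h2.const_mul Complex.I)).congr_deriv ?_
  rw [derivDual_apply, distributionToDual_apply]
  ring

end DeltaInvariant

end

theorem theorem2p1 (m : ℕ) (hm : 1 ≤ m) (h₁ h₂ : ℝ) (hh₁ : h₁ ≠ 0) (hh₂ : h₂ ≠ 0)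
    (hirr : Irrational (h₁ / h₂)) :
    (∀ V : Submodule ℂ C(ℝ, ℂ), FiniteDimensional ℂ V →
      V.map (DeltaInvariant.difference DeltaInvariant.translateFun h₁ ^ m) ≤ V →
      V.map (DeltaInvariant.difference DeltaInvariant.translateFun h₂ ^ m) ≤ V →
      (∃ W : Submodule ℂ C(ℝ, ℂ), FiniteDimensional ℂ W ∧
        DeltaInvariant.TranslationInvariant DeltaInvariant.translateFun W ∧ V ≤ W) ∧
      ∀ f ∈ V, DeltaInvariant.IsExpPoly f) ∧
    (∀ V : Submodule ℂ DeltaInvariant.ComplexDistribution, FiniteDimensional ℂ V →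
      V.map (DeltaInvariant.difference DeltaInvariant.translateDistribution h₁ ^ m) ≤ V →
      V.map (DeltaInvariant.difference DeltaInvariant.translateDistribution h₂ ^ m) ≤ V →
      (∃ W : Submodule ℂ DeltaInvariant.ComplexDistribution, FiniteDimensional ℂ W ∧
        DeltaInvariant.TranslationInvariant DeltaInvariant.translateDistribution W ∧ V ≤ W) ∧
      ∀ T ∈ V, DeltaInvariant.IsExpPolyDistribution T) := by
  refine ⟨fun V hV hV₁ hV₂ => ?_, fun V hV hV₁ hV₂ => ?_⟩
  · obtain ⟨hW, hexp⟩ := DeltaInvariant.exists_translationInvariant_of_embedding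
      DeltaInvariant.continuousMapToDual DeltaInvariant.continuousMapToDual_injective
      DeltaInvariant.continuousMapToDual_translateFun
      DeltaInvariant.isRegular_continuousMapToDual hm hirr hV₁ hV₂
    refine ⟨hW, fun f hf => ?_⟩
    obtain ⟨g, hg, hfg⟩ := hexp f hf
    -- `f` and `g` agree as functionals; both are continuous, so they agree at every point.
    have h : f = ⟨g, hg.continuous⟩ :=
      DeltaInvariant.continuousMapToDual_injective (LinearMap.ext hfg)
    rw [h]
    exact hg
  · obtain ⟨hW, hexp⟩ := DeltaInvariant.exists_translationInvariant_of_embedding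
      DeltaInvariant.distributionToDual DeltaInvariant.distributionToDual_injective
      DeltaInvariant.distributionToDual_translateDistribution
      DeltaInvariant.isRegular_distributionToDual hm hirr hV₁ hV₂
    refine ⟨hW, fun T hT => ?_⟩
    obtain ⟨g, hg, hTg⟩ := hexp T hT
    refine ⟨g, hg, fun φ => ?_⟩
    rw [← DeltaInvariant.distributionToDual_ofRealTest, hTg]
    rfl
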